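/- For $n \in \mathbb{N}$ let $S_n$ be the group of permutations of $[n] = \{1,\dots,n\}$, and for $i,j \in [n]$ let $x_{i,j}\colon S_n \to \{0,1\}$ be the indicator function of the set (coset) of permutations $\pi$ with $\pi(i) = j$. A function $f\colon S_n \to \mathbb{R}$ is linear if $f = \sum_{i,j=1}^n c_{i,j} x_{i,j}$ for some $c_{i,j} \in \mathbb{R}$. A dictator is a function of the form $\sum_{(i,j) \in \mathcal{C}} x_{i,j}$, where $\mathcal{C} \subseteq [n]^2$ is a set of pairs all of which have the same first coordinate, or all of which have the same second coordinate. Probabilities are with respect to a uniformly random $\pi \in S_n$. There exist absolute constants $K > 0$ and $M > 0$ such that the following holds for all $n \in \mathbb{N}$, all $\epsilon \ge 0$ and all $\delta > 0$. If $f\colon S_n \to \mathbb{R}$ is linear, $\Pr[f \notin \{0,1\}] \le \epsilon$, and $\delta \le \Pr[f = 1] \le 1 - \delta$, where $\delta \ge K\sqrt{\epsilon}$, then there is a dictator $g\colon S_n \to \mathbb{R}$ such that $\Pr[f \ne g] \le M \epsilon/\delta$. -/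

import Mathlib

namespace SymFKN

/-- The function `x_{i,j}` on `S_n`: the indicator of the coset of all permutations
sending `i` to `j`. -/
def cosetInd {n : ℕ} (i j : Fin n) (π : Equiv.Perm (Fin n)) : ℝ :=
  if π i = j then 1 else 0

/-- A function on `S_n` is linear if it is a real linear combination of the `x_{i,j}`. -/
def IsLinear {n : ℕ} (f : Equiv.Perm (Fin n) → ℝ) : Prop :=
  ∃ c : Fin n → Fin n → ℝ, ∀ π, f π = ∑ i, ∑ j, c i j * cosetInd i j π

/-- A dictator is a sum of the indicators of a family of cosets `(i, j)` which all lie on the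
same row (they have the same `i`) or all lie on the same column (they have the same `j`). -/
def IsDictator {n : ℕ} (g : Equiv.Perm (Fin n) → ℝ) : Prop :=
  ∃ C : Finset (Fin n × Fin n),
    ((∀ p ∈ C, ∀ q ∈ C, p.1 = q.1) ∨ (∀ p ∈ C, ∀ q ∈ C, p.2 = q.2)) ∧
    ∀ π, g π = ∑ p ∈ C, cosetInd p.1 p.2 π

open Classical in
/-- The probability that a uniformly random permutation in `S_n` satisfies `P`. -/
noncomputable def pr {n : ℕ} (P : Equiv.Perm (Fin n) → Prop) : ℝ :=
  ((Finset.univ.filter P).card : ℝ) / (Fintype.card (Equiv.Perm (Fin n)) : ℝ)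

end SymFKN

/-! Write f = `lin c`. Exchanging the values of π at two positions changes f by a mixed difference
(`minor`) of the matrix c, and exchanges at disjoint positions act independently. If both changes m,
m' are nonzero, the values a, a - m, a - m', a - m - m' are not all in {0, 1}, so one of four
permutations is bad (`exists_twist_lin_notMem`).

Up to a constant, f is the sum of its minors based at a row y and a column x, so f is nearly
constant when few of these are nonzero. To avoid choosing a base too early, let W be the set of
heavy cells, whose minors are nonzero for a quarter of all bases. Every nonzero minor has a heavy
corner, so averaging yields a base with support at most 4|W| (`exists_card_support_le`). Since f is
not nearly constant, |W| ≥ δn/4. On the other hand, each pair of heavy cells in different rows and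
columns produces many bad permutations, and double counting leaves only O(n²ε) such pairs
(`card_nonaligned_mul_le`). As ε is far below δ², this is far below |W|², so all but O(nε/δ) cells
of W lie on one line r. Averaging again over the other lines, f depends on π(r) alone (or on π⁻¹(r)
alone) outside probability O(ε/δ); rounding gives the dictator.

For n < 32 the hypothesis forces ε < 1/n!, so f is exactly Boolean, and `exists_line_minor_eq_zero`
gives the line. -/

namespace SymFKN

open Finset Equiv

/-! ### Mixed differences and normal forms -/

/-- The value at `π` of the linear function with coefficient matrix `c`. -/
def lin {n : ℕ} (c : Fin n → Fin n → ℝ) (π : Perm (Fin n)) : ℝ := ∑ i, c i (π i)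

/-- The mixed difference of the matrix `c` on rows `i, j` and columns `k, l`. -/
def minor {n : ℕ} (c : Fin n → Fin n → ℝ) (i j k l : Fin n) : ℝ :=
  c i k - c i l - c j k + c j l

theorem sum_cosetInd_eq_lin {n : ℕ} (c : Fin n → Fin n → ℝ) (π : Perm (Fin n)) :
    ∑ i, ∑ j, c i j * cosetInd i j π = lin c π := by
  simp [cosetInd, lin]

theorem lin_sub_lin_swap {n : ℕ} (c : Fin n → Fin n → ℝ) (π : Perm (Fin n)) {i j : Fin n}
    (hij : i ≠ j) : lin c π - lin c (π * swap i j) = minor c i j (π i) (π j) := by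
  have h : lin c π - lin c (π * swap i j) =
      ∑ a, (c a (π a) - c a (π (swap i j a))) := by
    simp [lin, sum_sub_distrib]
  rw [h, ← sum_subset (subset_univ {i, j}), sum_pair hij]
  · simp [minor]; ring
  · intro a _ ha
    simp only [mem_insert, mem_singleton, not_or] at ha
    rw [swap_apply_of_ne_of_ne ha.1 ha.2, sub_self]

/-- Adding to c a function of the row alone or of the column alone changes `lin c` by a constant;
here row y and column x are normalized to zero. -/
theorem lin_eq_const_add_sum_minor {n : ℕ} (c : Fin n → Fin n → ℝ) (y x : Fin n) :
    ∃ c₀ : ℝ, ∀ π, lin c π = c₀ + ∑ i, minor c i y (π i) x := by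
  refine ⟨∑ i, c i x + ∑ k, c y k - ∑ _i : Fin n, c y x, fun π => ?_⟩
  have h : ∑ k, c y (π k) = ∑ k, c y k := Equiv.sum_comp π (c y)
  simp only [minor, sum_add_distrib, sum_sub_distrib, h, lin]
  ring

/-! ### Counting and probability on the symmetric group -/

theorem descFactorial_mul_card_prescribed {n r : ℕ} (a b : Fin r → Fin n)
    (ha : Function.Injective a) (hb : Function.Injective b) :
    n.descFactorial r * #{π : Perm (Fin n) | ∀ t, π (a t) = b t} = n.factorial := by
  classical
  -- Left multiplication by a permutation taking e to b shows that all value tuples are equally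
  -- likely.
  have key : ∀ e : Fin r ↪ Fin n,
      #{π : Perm (Fin n) | (⟨fun t => π (a t), π.injective.comp ha⟩ : Fin r ↪ Fin n) = e} =
        #{π : Perm (Fin n) | ∀ t, π (a t) = b t} := by
    intro e
    obtain ⟨ρ, hρ⟩ := Perm.exists_extending_pair (f := e) (g := b) e.injective hb
    refine card_bij (fun π _ => ρ * π) ?_ ?_ ?_
    · intro π hπ
      simp only [mem_filter, mem_univ, true_and] at hπ ⊢
      intro t
      rw [Perm.mul_apply, ← hρ, ← hπ]
      rfl
    · intro π _ π' _ h
      exact mul_left_cancel h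
    · intro π hπ
      simp only [mem_filter, mem_univ, true_and] at hπ ⊢
      refine ⟨ρ⁻¹ * π, ?_, by simp⟩
      ext1 t
      change ρ⁻¹ (π (a t)) = e t
      rw [hπ, Perm.inv_eq_iff_eq, ← hρ]
  have h := card_eq_sum_card_fiberwise (s := (univ : Finset (Perm (Fin n))))
    (t := (univ : Finset (Fin r ↪ Fin n)))
    (f := fun π => ⟨fun t => π (a t), π.injective.comp ha⟩) (fun _ _ => mem_coe.2 (mem_univ _))
  simp only [key, sum_const, card_univ, Fintype.card_embedding_eq, Fintype.card_fin,
    Fintype.card_perm, smul_eq_mul] at h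
  exact h.symm

theorem mul_card_apply_eq {n : ℕ} (i k : Fin n) :
    n * #{π : Perm (Fin n) | π i = k} = n.factorial := by
  have h := descFactorial_mul_card_prescribed (r := 1) (fun _ => i) (fun _ => k)
    (Function.injective_of_subsingleton _) (Function.injective_of_subsingleton _)
  simpa using h

theorem pr_eq {n : ℕ} (P : Perm (Fin n) → Prop) [DecidablePred P] :
    pr P = (#{π | P π} : ℝ) / n.factorial := by
  unfold pr
  rw [Fintype.card_perm, Fintype.card_fin]
  congr!

theorem pr_mono {n : ℕ} {P Q : Perm (Fin n) → Prop} (h : ∀ π, P π → Q π) : pr P ≤ pr Q := by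
  classical
  rw [pr_eq, pr_eq]
  gcongr with π
  exact h π

theorem pr_or_le {n : ℕ} (P Q : Perm (Fin n) → Prop) : pr (fun π => P π ∨ Q π) ≤ pr P + pr Q := by
  classical
  rw [pr_eq, pr_eq, pr_eq, ← add_div]
  gcongr
  rw [filter_or]
  exact_mod_cast card_union_le _ _

theorem pr_not {n : ℕ} (P : Perm (Fin n) → Prop) : pr (fun π => ¬ P π) = 1 - pr P := by
  classical
  have h := card_filter_add_card_filter_not (s := (univ : Finset (Perm (Fin n)))) P
  have hc : (0 : ℝ) < n.factorial := by exact_mod_cast n.factorial_pos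
  rw [card_univ, Fintype.card_perm, Fintype.card_fin] at h
  rw [pr_eq, pr_eq, eq_sub_iff_add_eq, ← add_div, div_eq_one_iff_eq hc.ne', ← h]
  push_cast
  rw [add_comm]

theorem pr_comp_inv {n : ℕ} (P : Perm (Fin n) → Prop) : pr (fun π => P π⁻¹) = pr P := by
  classical
  rw [pr_eq, pr_eq]
  congr 2
  refine card_bij (fun π _ => π⁻¹) ?_ ?_ ?_
  · intro π hπ
    simpa using hπ
  · intro π _ π' _ h
    exact inv_injective h
  · intro π hπ
    exact ⟨π⁻¹, by simpa using hπ, by simp⟩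

theorem pr_exists_mem_le {n : ℕ} (T : Finset (Fin n × Fin n)) :
    pr (fun π => ∃ i, (i, π i) ∈ T) ≤ (#T : ℝ) / n := by
  classical
  rcases n.eq_zero_or_pos with rfl | hn
  · have h : (univ.filter fun π : Perm (Fin 0) => ∃ i, (i, π i) ∈ T) = ∅ :=
      filter_eq_empty_iff.2 fun π _ h => h.elim fun i _ => i.elim0
    rw [pr_eq, h]
    simp
  · have hn' : (0 : ℝ) < n := by exact_mod_cast hn
    have hf : (0 : ℝ) < n.factorial := by exact_mod_cast n.factorial_pos
    have hsub : (univ.filter fun π : Perm (Fin n) => ∃ i, (i, π i) ∈ T) ⊆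
        T.biUnion fun p => {π : Perm (Fin n) | π p.1 = p.2} := by
      intro π hπ
      obtain ⟨i, hi⟩ := (mem_filter.1 hπ).2
      exact mem_biUnion.2 ⟨_, hi, by simp⟩
    have h1 : n * #(univ.filter fun π : Perm (Fin n) => ∃ i, (i, π i) ∈ T) ≤
        #T * n.factorial := by
      calc _ ≤ n * ∑ p ∈ T, #{π : Perm (Fin n) | π p.1 = p.2} :=
            Nat.mul_le_mul_left _ ((card_le_card hsub).trans card_biUnion_le)
        _ = #T * n.factorial := by
            rw [mul_sum, sum_congr rfl fun p _ => mul_card_apply_eq p.1 p.2]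
            simp
    rw [pr_eq, div_le_div_iff₀ hf hn']
    rw [mul_comm]
    exact_mod_cast h1

/-! ### Dictators from small supports -/

open Classical in
/-- The cells in the rows `R` where the normal form of `c` based at row `y` and column `x`
does not vanish. -/
noncomputable def support {n : ℕ} (c : Fin n → Fin n → ℝ) (R : Finset (Fin n)) (y x : Fin n) :
    Finset (Fin n × Fin n) :=
  univ.filter fun p => p.1 ∈ R ∧ minor c p.1 y p.2 x ≠ 0

theorem mem_support {n : ℕ} {c : Fin n → Fin n → ℝ} {R : Finset (Fin n)} {y x : Fin n}
    {p : Fin n × Fin n} :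
    p ∈ support c R y x ↔ p.1 ∈ R ∧ minor c p.1 y p.2 x ≠ 0 := by
  simp [support]

/-- A permutation avoiding the support has f = h(π r), and a Boolean such value is the indicator of
h = 1. -/
theorem exists_isDictator_of_support {n : ℕ} (c : Fin n → Fin n → ℝ) (r y x : Fin n) :
    ∃ g : Perm (Fin n) → ℝ, IsDictator g ∧
      pr (fun π => lin c π ≠ g π) ≤
        pr (fun π => lin c π ∉ ({0, 1} : Set ℝ)) + (#(support c (univ.erase r) y x) : ℝ) / n := by
  classical
  obtain ⟨c₀, hc₀⟩ := lin_eq_const_add_sum_minor c y x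
  let h : Fin n → ℝ := fun k => c₀ + minor c r y k x
  let C : Finset (Fin n × Fin n) := univ.filter fun p => p.1 = r ∧ h p.2 = 1
  refine ⟨fun π => ∑ p ∈ C, cosetInd p.1 p.2 π, ⟨C, Or.inl ?_, fun _ => rfl⟩, ?_⟩
  · intro p hp q hq
    rw [(mem_filter.1 hp).2.1, (mem_filter.1 hq).2.1]
  have hg : ∀ π : Perm (Fin n), ∑ p ∈ C, cosetInd p.1 p.2 π = if h (π r) = 1 then 1 else 0 := by
    intro π
    simp only [cosetInd]
    rw [← sum_filter, sum_const, nsmul_eq_mul, mul_one]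
    split_ifs with h1
    · have : (C.filter fun p => π p.1 = p.2) = {(r, π r)} := by
        ext ⟨i, k⟩
        simp only [C, mem_filter, mem_univ, true_and, mem_singleton, Prod.mk.injEq]
        constructor
        · rintro ⟨⟨rfl, _⟩, rfl⟩
          exact ⟨rfl, rfl⟩
        · rintro ⟨rfl, rfl⟩
          exact ⟨⟨rfl, h1⟩, rfl⟩
      simp [this]
    · have : (C.filter fun p => π p.1 = p.2) = ∅ := by
        refine filter_eq_empty_iff.2 ?_
        rintro ⟨i, k⟩ hp he
        obtain ⟨rfl, h2⟩ := (mem_filter.1 hp).2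
        exact h1 (by rw [show π i = k from he]; exact h2)
      simp [this]
  refine (pr_mono ?_).trans ((pr_or_le _ _).trans (add_le_add le_rfl (pr_exists_mem_le _)))
  intro π hne
  by_contra hcon
  rw [not_or] at hcon
  obtain ⟨h01, hT⟩ := hcon
  apply hne
  have hval : lin c π = h (π r) := by
    rw [hc₀, ← add_sum_erase _ _ (mem_univ r), sum_eq_zero, add_zero]
    intro i hi
    by_contra hm
    exact hT ⟨i, mem_support.2 ⟨hi, hm⟩⟩
  simp only [hg]
  rw [not_not] at h01
  rcases h01 with h0 | h1
  · rw [if_neg (by rw [← hval, h0]; norm_num), h0]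
  · rw [if_pos (by rw [← hval, h1]), h1]

theorem lin_transpose {n : ℕ} (c : Fin n → Fin n → ℝ) (π : Perm (Fin n)) :
    lin (fun i j => c j i) π = lin c π⁻¹ := by
  unfold lin
  rw [← Equiv.sum_comp π fun j => c j (π⁻¹ j)]
  simp

theorem minor_transpose {n : ℕ} (c : Fin n → Fin n → ℝ) (i j k l : Fin n) :
    minor (fun i j => c j i) k l i j = minor c i j k l := by
  unfold minor
  ring

theorem IsDictator.comp_inv {n : ℕ} {g : Perm (Fin n) → ℝ} (hg : IsDictator g) :
    IsDictator fun π => g π⁻¹ := by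
  classical
  obtain ⟨C, hC, h⟩ := hg
  refine ⟨C.map (Equiv.prodComm _ _).toEmbedding, ?_, fun π => ?_⟩
  · rw [or_comm]
    refine hC.imp ?_ ?_
    all_goals
      intro hC p hp q hq
      obtain ⟨p', hp', rfl⟩ := mem_map.1 hp
      obtain ⟨q', hq', rfl⟩ := mem_map.1 hq
      exact hC p' hp' q' hq'
  · simp only [h]
    rw [sum_map]
    refine sum_congr rfl fun p _ => ?_
    simp only [cosetInd, Perm.inv_eq_iff_eq]
    simp [eq_comm]

theorem exists_isDictator_of_support_transpose {n : ℕ} (c : Fin n → Fin n → ℝ) (r y x : Fin n) :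
    ∃ g : Perm (Fin n) → ℝ, IsDictator g ∧
      pr (fun π => lin c π ≠ g π) ≤ pr (fun π => lin c π ∉ ({0, 1} : Set ℝ)) +
        (#(support (fun i j => c j i) (univ.erase r) y x) : ℝ) / n := by
  obtain ⟨g, hg, h⟩ := exists_isDictator_of_support (fun i j => c j i) r y x
  refine ⟨_, hg.comp_inv, ?_⟩
  simp only [lin_transpose] at h
  rw [← pr_comp_inv (fun π => lin c π ≠ _), ← pr_comp_inv (fun π => lin c π ∉ _)]
  simpa only [inv_inv] using h

/-! ### Heavy cells -/

open Classical in
/-- The cells `(i, k)` such that at least a quarter of all `(y, x)` make the minor of `c` on rows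
`i, y` and columns `k, x` nonzero. -/
noncomputable def heavyCells {n : ℕ} (c : Fin n → Fin n → ℝ) : Finset (Fin n × Fin n) :=
  univ.filter fun p => n ^ 2 ≤ 4 * #{q : Fin n × Fin n | minor c p.1 q.1 p.2 q.2 ≠ 0}

theorem mem_heavyCells {n : ℕ} {c : Fin n → Fin n → ℝ} {p : Fin n × Fin n}
    [DecidablePred fun q : Fin n × Fin n => minor c p.1 q.1 p.2 q.2 ≠ 0] :
    p ∈ heavyCells c ↔ n ^ 2 ≤ 4 * #{q : Fin n × Fin n | minor c p.1 q.1 p.2 q.2 ≠ 0} := by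
  simp only [heavyCells, mem_filter, mem_univ, true_and]
  congr!

/-- For every base q, the minor is the alternating sum of the four minors joining its corners to q,
so one of them is nonzero; by pigeonhole one corner serves a quarter of the bases. -/
theorem exists_heavyCell_corner {n : ℕ} {c : Fin n → Fin n → ℝ} {i j k l : Fin n}
    (h : minor c i j k l ≠ 0) :
    (i, k) ∈ heavyCells c ∨ (i, l) ∈ heavyCells c ∨ (j, k) ∈ heavyCells c ∨
      (j, l) ∈ heavyCells c := by
  classical
  let N : Fin n → Fin n → Finset (Fin n × Fin n) := fun a b =>
    {q : Fin n × Fin n | minor c a q.1 b q.2 ≠ 0}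
  have hcov : (univ : Finset (Fin n × Fin n)) ⊆ (N i k ∪ N i l) ∪ (N j k ∪ N j l) := by
    intro q _
    by_contra hq
    simp only [N, mem_union, mem_filter, mem_univ, true_and, not_or, not_not] at hq
    apply h
    have : minor c i j k l = minor c i q.1 k q.2 - minor c i q.1 l q.2 - minor c j q.1 k q.2
        + minor c j q.1 l q.2 := by unfold minor; ring
    rw [this, hq.1.1, hq.1.2, hq.2.1, hq.2.2]
    ring
  have h1 := card_le_card hcov
  have h2 := card_union_le (N i k ∪ N i l) (N j k ∪ N j l)
  have h3 := card_union_le (N i k) (N i l)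
  have h4 := card_union_le (N j k) (N j l)
  have h5 : #(univ : Finset (Fin n × Fin n)) = n ^ 2 := by simp [sq]
  by_contra hcon
  simp only [mem_heavyCells, not_or, not_le] at hcon
  simp only [N] at *
  omega

-- Average over the bases in R × [n]. Each nonzero minor is charged to a heavy corner and the
-- opposite cell, in one of four positions; taking y in R keeps all corners in the rows R.
open Classical in
theorem exists_card_support_le {n : ℕ} (c : Fin n → Fin n → ℝ) {R : Finset (Fin n)}
    (hR : R.Nonempty) :
    ∃ y ∈ R, ∃ x, #(support c R y x) ≤ 4 * #{p ∈ heavyCells c | p.1 ∈ R} := by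
  set W : Finset (Fin n × Fin n) := {p ∈ heavyCells c | p.1 ∈ R} with hW
  set B : Finset (Fin n × Fin n) := R ×ˢ univ with hB
  by_contra! hcon
  have hlow : #B * (4 * #W) < ∑ q ∈ B, #(support c R q.1 q.2) := by
    rw [← smul_eq_mul, ← sum_const]
    refine sum_lt_sum_of_nonempty ?_ fun q hq => hcon q.1 (mem_product.1 hq).1 q.2
    obtain ⟨y, hy⟩ := hR
    exact ⟨(y, y), by simp [hB, hy]⟩
  rw [← card_sigma] at hlow
  let F : (Fin n × Fin n) × (Fin n × Fin n) → Fin 4 → (Σ _ : Fin n × Fin n, Fin n × Fin n) :=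
    fun u => ![⟨u.2, u.1⟩, ⟨(u.2.1, u.1.2), (u.1.1, u.2.2)⟩, ⟨(u.1.1, u.2.2), (u.2.1, u.1.2)⟩,
      ⟨u.1, u.2⟩]
  have hsub : (B.sigma fun q => support c R q.1 q.2) ⊆
      univ.biUnion fun a : Fin 4 => (W ×ˢ B).image fun u => F u a := by
    rintro ⟨⟨j, l⟩, ⟨i, k⟩⟩ h
    obtain ⟨hj, h⟩ := mem_sigma.1 h
    have hj' : j ∈ R := (mem_product.1 hj).1
    obtain ⟨hi, hm⟩ := mem_support.1 h
    change i ∈ R at hi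
    simp only [mem_biUnion, mem_univ, true_and, mem_image, mem_product]
    rcases exists_heavyCell_corner hm with h | h | h | h
    · exact ⟨0, ((i, k), (j, l)), by simp [hW, hB, h, hi, hj'], rfl⟩
    · exact ⟨1, ((i, l), (j, k)), by simp [hW, hB, h, hi, hj'], rfl⟩
    · exact ⟨2, ((j, k), (i, l)), by simp [hW, hB, h, hi, hj'], rfl⟩
    · exact ⟨3, ((j, l), (i, k)), by simp [hW, hB, h, hi, hj'], rfl⟩
  have hup := (card_le_card hsub).trans card_biUnion_le
  have hup' : ∑ a : Fin 4, #((W ×ˢ B).image fun u => F u a) ≤ ∑ _a : Fin 4, #(W ×ˢ B) :=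
    sum_le_sum fun _ _ => card_image_le
  simp only [sum_const, card_univ, Fintype.card_fin, smul_eq_mul, card_product] at hup'
  have : #B * (4 * #W) = 4 * (#W * #B) := by ring
  omega

/-- Otherwise some normal form would make f constant with probability above 1 - δ, against both
bounds on Pr[f = 1]. -/
theorem mul_card_heavyCells_ge {n : ℕ} (c : Fin n → Fin n → ℝ) (hn : 0 < n) {δ : ℝ}
    (h1 : δ ≤ pr fun π => lin c π = 1) (h2 : (pr fun π => lin c π = 1) ≤ 1 - δ) :
    δ * n ≤ 4 * #(heavyCells c) := by
  classical
  have hn' : (0 : ℝ) < n := by exact_mod_cast hn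
  have : NeZero n := ⟨hn.ne'⟩
  obtain ⟨y, -, x, hx⟩ := exists_card_support_le c (R := univ) univ_nonempty
  simp only [mem_univ, filter_true] at hx
  obtain ⟨c₀, hc₀⟩ := lin_eq_const_add_sum_minor c y x
  have hconst : ∀ π, lin c π ≠ c₀ → ∃ i, (i, π i) ∈ support c univ y x := by
    intro π hπ
    by_contra! hcon
    apply hπ
    rw [hc₀, sum_eq_zero, add_zero]
    intro i _
    by_contra hm
    exact hcon i (mem_support.2 ⟨mem_univ _, hm⟩)
  have hle : δ ≤ (#(support c univ y x) : ℝ) / n := by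
    by_cases hc : c₀ = 1
    · have h3 := pr_not fun π => lin c π = 1
      have h4 : (pr fun π => ¬ lin c π = 1) ≤ _ :=
        (pr_mono fun π hπ => hconst π (by rwa [hc])).trans (pr_exists_mem_le _)
      linarith
    · exact h1.trans ((pr_mono fun π hπ => hconst π
        (by rw [hπ]; exact fun h => hc h.symm)).trans (pr_exists_mem_le _))
  rw [le_div_iff₀ hn'] at hle
  refine hle.trans ?_
  exact_mod_cast hx

/-! ### Few nonaligned pairs force concentration on a line -/

/-- The ordered pairs of cells of `W` that share neither a row nor a column. -/
def nonaligned {n : ℕ} (W : Finset (Fin n × Fin n)) :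
    Finset ((Fin n × Fin n) × (Fin n × Fin n)) :=
  (W ×ˢ W).filter fun u => u.1.1 ≠ u.2.1 ∧ u.1.2 ≠ u.2.2

theorem card_nonaligned {n : ℕ} (W : Finset (Fin n × Fin n)) :
    #(nonaligned W) = ∑ u ∈ W, #{v ∈ W | u.1 ≠ v.1 ∧ u.2 ≠ v.2} := by
  rw [nonaligned, card_filter, sum_product]
  simp only [card_filter]

theorem nonaligned_map_swap_card {n : ℕ} (W : Finset (Fin n × Fin n)) :
    #(nonaligned (W.map (Equiv.prodComm _ _).toEmbedding)) = #(nonaligned W) := by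
  rw [card_nonaligned, card_nonaligned, sum_map]
  refine sum_congr rfl fun u _ => ?_
  rw [filter_map, card_map]
  congr 1
  refine filter_congr fun v _ => ?_
  simp [and_comm]

/-- A cell off row r is nonaligned with every cell of that row except possibly the one in its own
column. -/
theorem card_off_row_mul_le {n : ℕ} {W : Finset (Fin n × Fin n)} (hW : 2 ≤ #W) {r : Fin n}
    (h : (99 / 100 : ℝ) * #W + 1 ≤ 2 * #{p ∈ W | p.1 = r}) :
    #{p ∈ W | p.1 ≠ r} * #W ≤ 5 * #(nonaligned W) := by
  have hge : ∀ v ∈ W, v.1 ≠ r →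
      (#W : ℝ) / 5 ≤ #{u ∈ W | v.1 ≠ u.1 ∧ v.2 ≠ u.2} := by
    intro v hv hr
    have hsub : {p ∈ W | p.1 = r} ⊆ insert (r, v.2) {u ∈ W | v.1 ≠ u.1 ∧ v.2 ≠ u.2} := by
      rintro ⟨a, b⟩ hp
      obtain ⟨hp', rfl⟩ := mem_filter.1 hp
      by_cases hb : v.2 = b
      · simp [hb]
      · exact mem_insert_of_mem (mem_filter.2 ⟨hp', hr, hb⟩)
    have h1 : #{p ∈ W | p.1 = r} ≤ #{u ∈ W | v.1 ≠ u.1 ∧ v.2 ≠ u.2} + 1 :=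
      (card_le_card hsub).trans (card_insert_le _ _)
    have h1' : (#{p ∈ W | p.1 = r} : ℝ) ≤ #{u ∈ W | v.1 ≠ u.1 ∧ v.2 ≠ u.2} + 1 := by
      exact_mod_cast h1
    have hW' : (2 : ℝ) ≤ #W := by exact_mod_cast hW
    linarith
  have hsum : (#{p ∈ W | p.1 ≠ r} : ℝ) * ((#W : ℝ) / 5) ≤ #(nonaligned W) := by
    rw [card_nonaligned, ← nsmul_eq_mul, ← sum_const]
    push_cast
    refine (sum_le_sum fun v hv => hge v (mem_filter.1 hv).1 (mem_filter.1 hv).2).trans ?_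
    exact sum_le_sum_of_subset_of_nonneg (filter_subset _ _) fun _ _ _ => by positivity
  have : (#{p ∈ W | p.1 ≠ r} : ℝ) * #W ≤ 5 * #(nonaligned W) := by linarith
  exact_mod_cast this

theorem exists_line_card_off_mul_le {n : ℕ} {W : Finset (Fin n × Fin n)} (hW : W.Nonempty)
    (h : 100 * #(nonaligned W) ≤ #W ^ 2) :
    ∃ r : Fin n, #{p ∈ W | p.1 ≠ r} * #W ≤ 5 * #(nonaligned W) ∨
      #{p ∈ W | p.2 ≠ r} * #W ≤ 5 * #(nonaligned W) := by
  have hpos := hW.card_pos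
  -- An average cell u has few nonaligned partners, so its row and column cover most of W. Counting
  -- u twice gives the extra +1.
  obtain ⟨u, hu, hle⟩ : ∃ u ∈ W, 100 * #{v ∈ W | u.1 ≠ v.1 ∧ u.2 ≠ v.2} ≤ #W := by
    by_contra! hcon
    have := sum_lt_sum_of_nonempty hW hcon
    rw [sum_const, ← mul_sum, ← card_nonaligned, smul_eq_mul, ← sq] at this
    omega
  rcases Nat.lt_or_ge 1 (#W) with h2 | h1
  · have hcov : W ⊆ ({p ∈ W | p.1 = u.1} ∪ {p ∈ W | p.2 = u.2}) ∪
        {v ∈ W | u.1 ≠ v.1 ∧ u.2 ≠ v.2} := by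
      intro p hp
      simp only [mem_union, mem_filter, hp, true_and]
      tauto
    have hc1 := (card_le_card hcov).trans (card_union_le _ _)
    have hc2 := card_union_add_card_inter {p ∈ W | p.1 = u.1} {p ∈ W | p.2 = u.2}
    have hc3 : 0 < #({p ∈ W | p.1 = u.1} ∩ {p ∈ W | p.2 = u.2}) :=
      card_pos.2 ⟨u, by simp [hu]⟩
    have hlarge : (99 / 100 : ℝ) * #W + 1 ≤ 2 * #{p ∈ W | p.1 = u.1} ∨
        (99 / 100 : ℝ) * #W + 1 ≤ 2 * #{p ∈ W | p.2 = u.2} := by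
      have hn : #W + 1 ≤ #{p ∈ W | p.1 = u.1} + #{p ∈ W | p.2 = u.2} +
          #{v ∈ W | u.1 ≠ v.1 ∧ u.2 ≠ v.2} := by omega
      have hn' : (#W : ℝ) + 1 ≤ #{p ∈ W | p.1 = u.1} + #{p ∈ W | p.2 = u.2} +
          #{v ∈ W | u.1 ≠ v.1 ∧ u.2 ≠ v.2} := by exact_mod_cast hn
      have hle' : (100 : ℝ) * #{v ∈ W | u.1 ≠ v.1 ∧ u.2 ≠ v.2} ≤ #W := by exact_mod_cast hle
      by_contra! hcon
      linarith [hcon.1, hcon.2]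
    rcases hlarge with hl | hl
    · exact ⟨u.1, Or.inl (card_off_row_mul_le h2 hl)⟩
    · refine ⟨u.2, Or.inr ?_⟩
      have h3 : #{p ∈ W.map (Equiv.prodComm _ _).toEmbedding | p.1 = u.2} =
          #{p ∈ W | p.2 = u.2} := by rw [filter_map, card_map]; rfl
      have h4 : #{p ∈ W.map (Equiv.prodComm _ _).toEmbedding | p.1 ≠ u.2} =
          #{p ∈ W | p.2 ≠ u.2} := by rw [filter_map, card_map]; rfl
      have h5 := card_off_row_mul_le (W := W.map (Equiv.prodComm _ _).toEmbedding) (r := u.2)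
        (by rw [card_map]; exact h2) (by rw [h3, card_map]; exact hl)
      rwa [h4, card_map, nonaligned_map_swap_card] at h5
  · refine ⟨u.1, Or.inl ?_⟩
    have : {p ∈ W | p.1 ≠ u.1} = ∅ := by
      refine filter_eq_empty_iff.2 fun p hp => ?_
      rw [card_le_one.1 h1 p hp u hu]
      simp
    simp [this]

theorem heavyCells_transpose {n : ℕ} (c : Fin n → Fin n → ℝ) :
    heavyCells (fun i j => c j i) = (heavyCells c).map (Equiv.prodComm _ _).toEmbedding := by
  classical
  ext ⟨k, i⟩
  have : (k, i) ∈ (heavyCells c).map (Equiv.prodComm _ _).toEmbedding ↔ (i, k) ∈ heavyCells c := by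
    simp
  rw [this, mem_heavyCells, mem_heavyCells]
  simp only [minor_transpose]
  have hcard : #{q : Fin n × Fin n | minor c i q.2 k q.1 ≠ 0} =
      #{q : Fin n × Fin n | minor c i q.1 k q.2 ≠ 0} := by
    refine card_bij (fun q _ => q.swap) ?_ ?_ ?_
    · intro q hq
      simpa using hq
    · intro q _ q' _ h
      exact Prod.swap_injective h
    · intro q hq
      exact ⟨q.swap, by simpa using hq, by simp⟩
  rw [hcard]

/-! ### Tools for double counting -/

theorem card_mul_le_of_forall_fiber {α β : Type*} {s : Finset α} {t : Finset (α × β)} {m k : ℕ}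
    (h : ∀ a ∈ s, ∃ B : Finset β, (∀ b ∈ B, (a, b) ∈ t) ∧ m ≤ k * #B) : #s * m ≤ k * #t := by
  classical
  have : ∀ a, ∃ B : Finset β, a ∈ s → (∀ b ∈ B, (a, b) ∈ t) ∧ m ≤ k * #B := by
    intro a
    by_cases ha : a ∈ s
    · obtain ⟨B, hB⟩ := h a ha
      exact ⟨B, fun _ => hB⟩
    · exact ⟨∅, fun h => (ha h).elim⟩
  choose B hB using this
  have h1 : #(s.sigma B) ≤ #t := by
    refine card_le_card_of_injOn (fun u => (u.1, u.2)) ?_ ?_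
    · intro u hu
      obtain ⟨h1, h2⟩ := mem_sigma.1 hu
      exact (hB _ h1).1 _ h2
    · rintro ⟨a, b⟩ _ ⟨a', b'⟩ _ h
      simpa using h
  rw [card_sigma] at h1
  calc #s * m = ∑ _a ∈ s, m := by simp
    _ ≤ ∑ a ∈ s, k * #(B a) := sum_le_sum fun a ha => (hB a ha).2
    _ = k * ∑ a ∈ s, #(B a) := by rw [mul_sum]
    _ ≤ k * #t := Nat.mul_le_mul_left _ h1

theorem card_le_card_avoiding_add {n : ℕ} (A : Finset (Fin n × Fin n)) (a₁ a₂ b₁ b₂ : Fin n) :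
    #A ≤ #{e ∈ A | e.1 ≠ a₁ ∧ e.1 ≠ a₂ ∧ e.2 ≠ b₁ ∧ e.2 ≠ b₂} + 4 * n := by
  have hsub : A ⊆ {e ∈ A | e.1 ≠ a₁ ∧ e.1 ≠ a₂ ∧ e.2 ≠ b₁ ∧ e.2 ≠ b₂} ∪
      (({a₁, a₂} ×ˢ univ) ∪ (univ ×ˢ {b₁, b₂})) := by
    intro e he
    simp only [mem_union, mem_filter, mem_product, mem_insert, mem_singleton, mem_univ, he,
      true_and, and_true]
    tauto
  have h1 := (card_le_card hsub).trans (card_union_le _ _)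
  have h2 := card_union_le (({a₁, a₂} : Finset (Fin n)) ×ˢ (univ : Finset (Fin n)))
    (univ ×ˢ {b₁, b₂})
  rw [card_product, card_product, card_univ, Fintype.card_fin] at h2
  have h3 := Nat.mul_le_mul_right n (card_le_two (a := a₁) (b := a₂))
  have h4 := Nat.mul_le_mul_left n (card_le_two (a := b₁) (b := b₂))
  omega

/-- Given the four prescribed values, each other cell of W is hit with probability at most 1/(n -
4), so at most 5 are hit on average; Markov's inequality does the rest. -/
theorem card_prescribed_le_two_mul {n : ℕ} (hn : 32 ≤ n) {a b : Fin 4 → Fin n}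
    (ha : Function.Injective a) (hb : Function.Injective b) {W : Finset (Fin n × Fin n)}
    (hW : #W ≤ 4 * n) :
    #{π : Perm (Fin n) | ∀ t, π (a t) = b t} ≤ 2 * #{π : Perm (Fin n) | (∀ t, π (a t) = b t) ∧
      #{e ∈ W | (∀ t, e.1 ≠ a t) ∧ π e.1 = e.2} ≤ 10} := by
  set P : Finset (Perm (Fin n)) := {π | ∀ t, π (a t) = b t} with hP
  let V : Perm (Fin n) → ℕ := fun π => #{e ∈ W | (∀ t, e.1 ≠ a t) ∧ π e.1 = e.2}
  have hcell : ∀ e ∈ W, (n - 4) * #{π ∈ P | (∀ t, e.1 ≠ a t) ∧ π e.1 = e.2} ≤ #P := by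
    intro e _
    by_cases h1 : ∀ t, e.1 ≠ a t
    · by_cases h2 : ∀ t, e.2 ≠ b t
      · have ha' : Function.Injective (Fin.cons e.1 a : Fin 5 → Fin n) := by
          rw [Fin.cons_injective_iff]
          exact ⟨by rintro ⟨t, ht⟩; exact h1 t ht.symm, ha⟩
        have hb' : Function.Injective (Fin.cons e.2 b : Fin 5 → Fin n) := by
          rw [Fin.cons_injective_iff]
          exact ⟨by rintro ⟨t, ht⟩; exact h2 t ht.symm, hb⟩
        have h5 := descFactorial_mul_card_prescribed _ _ ha' hb'
        rw [← descFactorial_mul_card_prescribed a b ha hb, Nat.descFactorial_succ,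
          mul_comm (n - 4), mul_assoc] at h5
        have h6 := Nat.eq_of_mul_eq_mul_left
          (Nat.descFactorial_pos.2 (by omega)) h5
        have h7 : ({π ∈ P | (∀ t, e.1 ≠ a t) ∧ π e.1 = e.2} : Finset (Perm (Fin n))) =
            ({π : Perm (Fin n) | ∀ t, π ((Fin.cons e.1 a : Fin 5 → Fin n) t) =
              (Fin.cons e.2 b : Fin 5 → Fin n) t} : Finset (Perm (Fin n))) := by
          ext π
          simp only [hP, mem_filter, mem_univ, true_and, Fin.forall_fin_succ (n := 4),
            Fin.cons_zero, Fin.cons_succ]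
          tauto
        rw [h7, h6]
      · push Not at h2
        obtain ⟨t, ht⟩ := h2
        have : ({π ∈ P | (∀ t, e.1 ≠ a t) ∧ π e.1 = e.2} : Finset (Perm (Fin n))) = ∅ := by
          refine filter_eq_empty_iff.2 fun π hπ h => ?_
          have h8 := (mem_filter.1 hπ).2 t
          rw [← ht, ← h.2] at h8
          exact h1 t (π.injective h8).symm
        rw [this]
        simp
    · simp [h1]
  have hsum : ∑ π ∈ P, V π = ∑ e ∈ W, #{π ∈ P | (∀ t, e.1 ≠ a t) ∧ π e.1 = e.2} := by
    simp only [V, card_filter]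
    exact sum_comm
  have hsum' : (n - 4) * ∑ π ∈ P, V π ≤ #W * #P := by
    rw [hsum, mul_sum, ← smul_eq_mul, ← sum_const]
    exact sum_le_sum hcell
  have hle : ∑ π ∈ P, V π ≤ 5 * #P := by
    have h1 : (n - 4) * ∑ π ∈ P, V π ≤ (n - 4) * (5 * #P) := by
      calc _ ≤ #W * #P := hsum'
        _ ≤ ((n - 4) * 5) * #P := Nat.mul_le_mul_right _ (by omega)
        _ = _ := by ring
    exact Nat.le_of_mul_le_mul_left h1 (by omega)
  have hbad : #{π ∈ P | ¬ V π ≤ 10} * 11 ≤ ∑ π ∈ P, V π := by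
    rw [← smul_eq_mul, ← sum_const]
    refine (sum_le_sum fun π hπ => ?_).trans (sum_le_sum_of_subset (filter_subset _ P))
    have := (mem_filter.1 hπ).2
    omega
  have hsplit := card_filter_add_card_filter_not (s := P) fun π => V π ≤ 10
  have heq : ({π : Perm (Fin n) | (∀ t, π (a t) = b t) ∧
      #{e ∈ W | (∀ t, e.1 ≠ a t) ∧ π e.1 = e.2} ≤ 10} : Finset _) = {π ∈ P | V π ≤ 10} := by
    rw [hP, filter_filter]
  rw [heq]
  omega

/-! ### Twists, configurations and bad permutations -/

/-- The permutation that performs the transpositions `z` and `z'` as indicated by `s`. -/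
def twist {n : ℕ} (s : Bool × Bool) (z z' : Fin n × Fin n) : Perm (Fin n) :=
  (if s.1 then swap z.1 z.2 else 1) * (if s.2 then swap z'.1 z'.2 else 1)

theorem twist_apply_of_ne {n : ℕ} (s : Bool × Bool) {z z' : Fin n × Fin n} {j : Fin n}
    (h1 : j ≠ z.1) (h2 : j ≠ z.2) (h3 : j ≠ z'.1) (h4 : j ≠ z'.2) : twist s z z' j = j := by
  obtain ⟨s₁, s₂⟩ := s
  cases s₁ <;> cases s₂ <;> simp [twist, swap_apply_of_ne_of_ne, *]

theorem exists_twist_lin_notMem {n : ℕ} (c : Fin n → Fin n → ℝ) (π : Perm (Fin n))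
    {z z' : Fin n × Fin n} (h1 : z.1 ≠ z'.1) (h2 : z.1 ≠ z'.2) (h3 : z.2 ≠ z'.1)
    (h4 : z.2 ≠ z'.2) (hm : minor c z.1 z.2 (π z.1) (π z.2) ≠ 0)
    (hm' : minor c z'.1 z'.2 (π z'.1) (π z'.2) ≠ 0) :
    ∃ s, lin c (π * twist s z z') ∉ ({0, 1} : Set ℝ) := by
  have hz : z.1 ≠ z.2 := fun h => hm (by unfold minor; rw [h]; ring)
  have hz' : z'.1 ≠ z'.2 := fun h => hm' (by unfold minor; rw [h]; ring)
  by_contra! hcon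
  have e1 := lin_sub_lin_swap c π hz
  have e2 := lin_sub_lin_swap c π hz'
  have e3 := lin_sub_lin_swap c (π * swap z.1 z.2) hz'
  have e4 : (π * swap z.1 z.2) z'.1 = π z'.1 := by
    rw [Perm.mul_apply, swap_apply_of_ne_of_ne h1.symm h3.symm]
  have e5 : (π * swap z.1 z.2) z'.2 = π z'.2 := by
    rw [Perm.mul_apply, swap_apply_of_ne_of_ne h2.symm h4.symm]
  rw [e4, e5, mul_assoc] at e3
  have f0 := hcon (false, false)
  have f1 := hcon (true, false)
  have f2 := hcon (false, true)
  have f3 := hcon (true, true)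
  simp only [twist, if_true, if_false, mul_one, one_mul, Bool.false_eq_true,
    Set.mem_insert_iff, Set.mem_singleton_iff] at f0 f1 f2 f3
  rcases f0 with f0 | f0 <;> rcases f1 with f1 | f1 <;> rcases f2 with f2 | f2 <;>
    rcases f3 with f3 | f3 <;> rw [f0] at e1 e2 <;> rw [f1] at e1 e3 <;> rw [f2] at e2 <;>
    rw [f3] at e3 <;>
    first
    | exact hm (by linarith)
    | exact hm' (by linarith)

/-- The pairs `(i, y)` of positions such that `W` contains the cell of `ρ` in row `i`, or the
cell to which row `i` moves when the values of `ρ` at `i` and `y` are exchanged. -/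
def meetingPairs {n : ℕ} (W : Finset (Fin n × Fin n)) (ρ : Perm (Fin n)) :
    Finset (Fin n × Fin n) :=
  univ.filter fun z => (z.1, ρ z.1) ∈ W ∨ (z.1, ρ z.2) ∈ W

theorem card_meetingPairs_le {n : ℕ} (W : Finset (Fin n × Fin n)) (ρ : Perm (Fin n)) :
    #(meetingPairs W ρ) ≤ #{e ∈ W | ρ e.1 = e.2} * n + #W := by
  have hsub : meetingPairs W ρ ⊆
      (({e ∈ W | ρ e.1 = e.2} ×ˢ (univ : Finset (Fin n))).image fun u => (u.1.1, u.2)) ∪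
        W.image fun e => (e.1, ρ⁻¹ e.2) := by
    rintro ⟨i, y⟩ h
    simp only [mem_union, mem_image]
    rcases (mem_filter.1 h).2 with h | h
    · exact Or.inl ⟨((i, ρ i), y), by simpa using h, rfl⟩
    · exact Or.inr ⟨(i, ρ y), h, by simp⟩
  refine (card_le_card hsub).trans ((card_union_le _ _).trans ?_)
  refine add_le_add (card_image_le.trans ?_) card_image_le
  rw [card_product, card_univ, Fintype.card_fin]

/-- A pair of nonaligned cells `p, q`, a second corner `e`, `e'` for each of them such that both
minors are nonzero, and a permutation through these four cells that contains few other cells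
of `W`. -/
structure IsConfig {n : ℕ} (c : Fin n → Fin n → ℝ) (W : Finset (Fin n × Fin n))
    (p q e e' : Fin n × Fin n) (π : Perm (Fin n)) : Prop where
  mem_left : p ∈ W
  mem_right : q ∈ W
  ne : p.1 ≠ q.1
  ne_e : e.1 ≠ q.1
  ne_e' : e'.1 ≠ p.1
  e_ne_e' : e'.1 ≠ e.1
  minor_left : minor c p.1 e.1 p.2 e.2 ≠ 0
  minor_right : minor c q.1 e'.1 q.2 e'.2 ≠ 0
  apply_p : π p.1 = p.2
  apply_e : π e.1 = e.2
  apply_q : π q.1 = q.2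
  apply_e' : π e'.1 = e'.2
  card_le : #{u ∈ W | (u.1 ≠ p.1 ∧ u.1 ≠ e.1 ∧ u.1 ≠ q.1 ∧ u.1 ≠ e'.1) ∧ π u.1 = u.2} ≤ 10

namespace IsConfig

variable {n : ℕ} {c : Fin n → Fin n → ℝ} {W : Finset (Fin n × Fin n)} {p q e e' : Fin n × Fin n}
  {π : Perm (Fin n)}

theorem exists_twist (h : IsConfig c W p q e e' π) :
    ∃ s, lin c (π * twist s (p.1, e.1) (q.1, e'.1)) ∉ ({0, 1} : Set ℝ) :=
  exists_twist_lin_notMem c π h.ne h.ne_e'.symm h.ne_e h.e_ne_e'.symm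
    (by simpa [h.apply_p, h.apply_e] using h.minor_left)
    (by simpa [h.apply_q, h.apply_e'] using h.minor_right)

theorem mem_meetingPairs_left (h : IsConfig c W p q e e' π) (s : Bool × Bool) :
    (p.1, e.1) ∈ meetingPairs W (π * twist s (p.1, e.1) (q.1, e'.1)) := by
  refine mem_filter.2 ⟨mem_univ _, ?_⟩
  have h1 := h.ne
  have h2 := h.ne_e'.symm
  have h3 := h.ne_e
  have h4 := h.e_ne_e'.symm
  have h5 := h.mem_left
  obtain ⟨s₁, s₂⟩ := s
  cases s₁ <;> cases s₂ <;>
    simp [twist, swap_apply_of_ne_of_ne, h.apply_p, *]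

theorem mem_meetingPairs_right (h : IsConfig c W p q e e' π) (s : Bool × Bool) :
    (q.1, e'.1) ∈ meetingPairs W (π * twist s (p.1, e.1) (q.1, e'.1)) := by
  refine mem_filter.2 ⟨mem_univ _, ?_⟩
  have h1 := h.ne.symm
  have h2 := h.ne_e'
  have h3 := h.ne_e.symm
  have h4 := h.e_ne_e'
  have h5 := h.mem_right
  obtain ⟨s₁, s₂⟩ := s
  cases s₁ <;> cases s₂ <;>
    simp [twist, swap_apply_of_ne_of_ne, h.apply_q, *]

theorem card_cells_le (h : IsConfig c W p q e e' π) (s : Bool × Bool) :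
    #{u ∈ W | (π * twist s (p.1, e.1) (q.1, e'.1)) u.1 = u.2} ≤ 14 := by
  -- The twist alters only four rows, which add at most 4 cells to the 10 allowed by `card_le`.
  set ρ := π * twist s (p.1, e.1) (q.1, e'.1) with hρ
  have hsub : {u ∈ W | ρ u.1 = u.2} ⊆
      {u ∈ W | (u.1 ≠ p.1 ∧ u.1 ≠ e.1 ∧ u.1 ≠ q.1 ∧ u.1 ≠ e'.1) ∧ π u.1 = u.2} ∪
        univ.image fun t : Fin 4 => (![p.1, e.1, q.1, e'.1] t, ρ (![p.1, e.1, q.1, e'.1] t)) := by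
    rintro ⟨a, b⟩ hu
    obtain ⟨hu, rfl⟩ : (a, b) ∈ W ∧ ρ a = b := mem_filter.1 hu
    by_cases ha : a ≠ p.1 ∧ a ≠ e.1 ∧ a ≠ q.1 ∧ a ≠ e'.1
    · refine mem_union_left _ (mem_filter.2 ⟨hu, ha, ?_⟩)
      simp only [hρ, Perm.mul_apply]
      rw [twist_apply_of_ne (z := (p.1, e.1)) (z' := (q.1, e'.1)) s ha.1 ha.2.1 ha.2.2.1
        ha.2.2.2]
    · refine mem_union_right _ (mem_image.2 ?_)
      simp only [mem_univ, true_and, Fin.exists_fin_succ]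
      simp
      by_contra! hcon
      exact ha ⟨fun h => hcon.1 h.symm, fun h => hcon.2.1 h.symm, fun h => hcon.2.2.1 h.symm,
        fun h => hcon.2.2.2 h.symm⟩
  have h1 := (card_le_card hsub).trans (card_union_le _ _)
  have h2 : #(univ.image fun t : Fin 4 =>
      (![p.1, e.1, q.1, e'.1] t, ρ (![p.1, e.1, q.1, e'.1] t))) ≤ 4 := card_image_le
  have h3 := h.card_le
  omega

end IsConfig

open Classical in
/-- The set of all configurations. -/
noncomputable def configs {n : ℕ} (c : Fin n → Fin n → ℝ) (W : Finset (Fin n × Fin n)) :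
    Finset (((((Fin n × Fin n) × (Fin n × Fin n)) × (Fin n × Fin n)) × (Fin n × Fin n)) ×
      Perm (Fin n)) :=
  univ.filter fun ω => IsConfig c W ω.1.1.1.1 ω.1.1.1.2 ω.1.1.2 ω.1.2 ω.2

-- A configuration is recovered from s, the bad twisted permutation ρ and the two row pairs: ρ and s
-- give back π, and π gives the columns. Both row pairs are meeting pairs of ρ, so each has only 18n
-- = 14n + 4n possibilities rather than n².
open Classical in
theorem card_configs_le {n : ℕ} (c : Fin n → Fin n → ℝ) {W : Finset (Fin n × Fin n)}
    (hW : #W ≤ 4 * n) :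
    #(configs c W) ≤
      4 * (#{π : Perm (Fin n) | lin c π ∉ ({0, 1} : Set ℝ)} * (18 * n) ^ 2) := by
  set B : Finset (Perm (Fin n)) :=
    {π | lin c π ∉ ({0, 1} : Set ℝ) ∧ #(meetingPairs W π) ≤ 18 * n} with hB
  set T := B.sigma fun ρ => meetingPairs W ρ ×ˢ meetingPairs W ρ with hT
  have hTcard : #T ≤ #{π : Perm (Fin n) | lin c π ∉ ({0, 1} : Set ℝ)} * (18 * n) ^ 2 := by
    rw [hT, card_sigma]
    calc _ ≤ ∑ _ρ ∈ B, (18 * n) ^ 2 := by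
          refine sum_le_sum fun ρ hρ => ?_
          rw [card_product, ← sq]
          exact Nat.pow_le_pow_left (mem_filter.1 hρ).2.2 2
      _ = #B * (18 * n) ^ 2 := by simp
      _ ≤ _ := Nat.mul_le_mul_right _ (card_le_card
          (monotone_filter_right _ fun _ _ h => h.1))
  have hsub : configs c W ⊆ (univ : Finset (Bool × Bool)).biUnion fun s =>
      {ω ∈ configs c W | lin c (ω.2 * twist s (ω.1.1.1.1.1, ω.1.1.2.1) (ω.1.1.1.2.1, ω.1.2.1)) ∉
        ({0, 1} : Set ℝ)} := by
    intro ω hω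
    obtain ⟨s, hs⟩ := (mem_filter.1 hω).2.exists_twist
    exact mem_biUnion.2 ⟨s, mem_univ _, mem_filter.2 ⟨hω, hs⟩⟩
  have hpart : ∀ s : Bool × Bool, #{ω ∈ configs c W | lin c (ω.2 *
      twist s (ω.1.1.1.1.1, ω.1.1.2.1) (ω.1.1.1.2.1, ω.1.2.1)) ∉ ({0, 1} : Set ℝ)} ≤ #T := by
    intro s
    refine card_le_card_of_injOn (fun ω =>
      ⟨ω.2 * twist s (ω.1.1.1.1.1, ω.1.1.2.1) (ω.1.1.1.2.1, ω.1.2.1),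
        ((ω.1.1.1.1.1, ω.1.1.2.1), (ω.1.1.1.2.1, ω.1.2.1))⟩) ?_ ?_
    · intro ω hω
      obtain ⟨hω, hbad⟩ := mem_filter.1 hω
      have hc := (mem_filter.1 hω).2
      refine mem_sigma.2 ⟨mem_filter.2 ⟨mem_univ _, hbad, ?_⟩,
        mem_product.2 ⟨hc.mem_meetingPairs_left s, hc.mem_meetingPairs_right s⟩⟩
      refine (card_meetingPairs_le W _).trans ?_
      calc _ ≤ 14 * n + 4 * n := add_le_add (Nat.mul_le_mul_right n (hc.card_cells_le s)) hW
        _ = 18 * n := by ring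
    · rintro ⟨⟨⟨⟨⟨i, k⟩, ⟨i', k'⟩⟩, ⟨y, x⟩⟩, ⟨y', x'⟩⟩, π⟩ hω
        ⟨⟨⟨⟨⟨j, l⟩, ⟨j', l'⟩⟩, ⟨z, w⟩⟩, ⟨z', w'⟩⟩, σ⟩ hω' h
      have hc := (mem_filter.1 (mem_filter.1 hω).1).2
      have hc' := (mem_filter.1 (mem_filter.1 hω').1).2
      simp only [Sigma.mk.injEq, heq_eq_eq, Prod.mk.injEq] at h
      obtain ⟨h, ⟨rfl, rfl⟩, rfl, rfl⟩ := h
      obtain rfl := mul_right_cancel h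
      have e1 := hc.apply_p.symm.trans hc'.apply_p
      have e2 := hc.apply_q.symm.trans hc'.apply_q
      have e3 := hc.apply_e.symm.trans hc'.apply_e
      have e4 := hc.apply_e'.symm.trans hc'.apply_e'
      simp only at e1 e2 e3 e4
      subst e1 e2 e3 e4
      rfl
  calc #(configs c W) ≤ ∑ s : Bool × Bool, #T :=
        (card_le_card hsub).trans (card_biUnion_le.trans (sum_le_sum fun s _ => hpart s))
    _ = 4 * #T := by simp
    _ ≤ _ := Nat.mul_le_mul_left _ hTcard

-- Heaviness leaves at least n²/8 choices for each of e and e' after discarding the lines already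
-- used (hence 32 ≤ n), and at least n!/(2n⁴) permutations pass through the four cells; 128 = 8 · 8
-- · 2.
open Classical in
theorem card_nonaligned_mul_le_card_configs {n : ℕ} (hn : 32 ≤ n) (c : Fin n → Fin n → ℝ)
    {W : Finset (Fin n × Fin n)} (hW : #W ≤ 4 * n) (hheavy : W ⊆ heavyCells c) :
    #(nonaligned W) * n.factorial ≤ 128 * #(configs c W) := by
  have hheavy' : ∀ p ∈ W, n ^ 2 ≤ 4 * #{e : Fin n × Fin n | minor c p.1 e.1 p.2 e.2 ≠ 0} :=
    fun p hp => mem_heavyCells.1 (hheavy hp)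
  have hn2 : 32 * n ≤ n ^ 2 := by nlinarith
  have harith : ∀ {a b : ℕ}, n ^ 2 ≤ 4 * a → a ≤ b + 4 * n → n ^ 2 ≤ 8 * b := by
    intro a b h1 h2
    omega
  set S₂ : Finset (((Fin n × Fin n) × (Fin n × Fin n)) × (Fin n × Fin n)) :=
    {ω | ω.1 ∈ nonaligned W ∧ minor c ω.1.1.1 ω.2.1 ω.1.1.2 ω.2.2 ≠ 0 ∧
      ω.2.1 ≠ ω.1.2.1 ∧ ω.2.2 ≠ ω.1.2.2} with hS₂
  have h₂ : #(nonaligned W) * n ^ 2 ≤ 8 * #S₂ := by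
    refine card_mul_le_of_forall_fiber fun u hu => ?_
    have hp : u.1 ∈ W := (mem_product.1 (mem_filter.1 hu).1).1
    have h1 := hheavy' _ hp
    have h2 := card_le_card_avoiding_add
      {e : Fin n × Fin n | minor c u.1.1 e.1 u.1.2 e.2 ≠ 0} u.2.1 u.2.1 u.2.2 u.2.2
    refine ⟨_, fun e he => ?_, harith h1 h2⟩
    rw [mem_filter, mem_filter] at he
    exact mem_filter.2 ⟨mem_univ _, hu, he.1.2, he.2.1, he.2.2.2.1⟩
  set S₃ : Finset ((((Fin n × Fin n) × (Fin n × Fin n)) × (Fin n × Fin n)) × (Fin n × Fin n)) :=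
    {ω | ω.1 ∈ S₂ ∧ minor c ω.1.1.2.1 ω.2.1 ω.1.1.2.2 ω.2.2 ≠ 0 ∧
      ω.2.1 ≠ ω.1.1.1.1 ∧ ω.2.1 ≠ ω.1.2.1 ∧ ω.2.2 ≠ ω.1.1.1.2 ∧ ω.2.2 ≠ ω.1.2.2} with hS₃
  have h₃ : #S₂ * n ^ 2 ≤ 8 * #S₃ := by
    refine card_mul_le_of_forall_fiber fun u hu => ?_
    have hq : u.1.2 ∈ W := (mem_product.1 (mem_filter.1 (mem_filter.1 hu).2.1).1).2
    have h1 := hheavy' _ hq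
    have h2 := card_le_card_avoiding_add
      {e : Fin n × Fin n | minor c u.1.2.1 e.1 u.1.2.2 e.2 ≠ 0} u.1.1.1 u.2.1 u.1.1.2 u.2.2
    refine ⟨_, fun e he => ?_, harith h1 h2⟩
    rw [mem_filter, mem_filter] at he
    exact mem_filter.2 ⟨mem_univ _, hu, he.1.2, he.2⟩
  have h₄ : #S₃ * n.factorial ≤ (2 * n ^ 4) * #(configs c W) := by
    refine card_mul_le_of_forall_fiber fun u hu => ?_
    obtain ⟨⟨⟨p, q⟩, e⟩, e'⟩ := u
    obtain ⟨hu, hm', h1, h2, h3, h4⟩ := (mem_filter.1 hu).2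
    obtain ⟨hu, hm, h5, h6⟩ := (mem_filter.1 hu).2
    obtain ⟨hu, h7, h8⟩ := mem_filter.1 hu
    obtain ⟨hp, hq⟩ := mem_product.1 hu
    dsimp only at hp hq hm hm' h1 h2 h3 h4 h5 h6 h7 h8
    have n1 : p.1 ≠ e.1 := fun he => hm (by unfold minor; rw [he]; ring)
    have n2 : p.2 ≠ e.2 := fun he => hm (by unfold minor; rw [he]; ring)
    have n3 : q.1 ≠ e'.1 := fun he => hm' (by unfold minor; rw [he]; ring)
    have n4 : q.2 ≠ e'.2 := fun he => hm' (by unfold minor; rw [he]; ring)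
    have ha : Function.Injective ![p.1, e.1, q.1, e'.1] := by
      intro s t
      fin_cases s <;> fin_cases t <;> simp [*, Ne.symm, eq_comm] <;> tauto
    have hb : Function.Injective ![p.2, e.2, q.2, e'.2] := by
      intro s t
      fin_cases s <;> fin_cases t <;> simp [*, Ne.symm, eq_comm] <;> tauto
    have hle := card_prescribed_le_two_mul hn ha hb hW
    have hle' := (descFactorial_mul_card_prescribed _ _ ha hb).symm.le.trans
      (Nat.mul_le_mul (Nat.descFactorial_le_pow n 4) hle)
    rw [← mul_assoc, mul_comm (n ^ 4) 2] at hle'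
    refine ⟨_, fun π hπ => ?_, hle'⟩
    obtain ⟨hπ, hcard⟩ := (mem_filter.1 hπ).2
    refine mem_filter.2 ⟨mem_univ _, ?_⟩
    simp only [Fin.forall_fin_succ, IsEmpty.forall_iff, and_true] at hcard
    exact ⟨hp, hq, h7, h5, h1, h2, hm, hm', hπ 0, hπ 1, hπ 2, hπ 3, hcard⟩
  have hpos : 0 < n ^ 4 := by positivity
  refine Nat.le_of_mul_le_mul_left ?_ hpos
  calc n ^ 4 * (#(nonaligned W) * n.factorial)
      = (#(nonaligned W) * n ^ 2) * (n ^ 2 * n.factorial) := by ring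
    _ ≤ (8 * #S₂) * (n ^ 2 * n.factorial) := Nat.mul_le_mul_right _ h₂
    _ = 8 * ((#S₂ * n ^ 2) * n.factorial) := by ring
    _ ≤ 8 * ((8 * #S₃) * n.factorial) := by gcongr
    _ = 64 * (#S₃ * n.factorial) := by ring
    _ ≤ 64 * ((2 * n ^ 4) * #(configs c W)) := by gcongr
    _ = n ^ 4 * (128 * #(configs c W)) := by ring

theorem card_nonaligned_mul_le {n : ℕ} (hn : 32 ≤ n) (c : Fin n → Fin n → ℝ)
    {W : Finset (Fin n × Fin n)} (hW : #W ≤ 4 * n) (hheavy : W ⊆ heavyCells c) :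
    (#(nonaligned W) : ℝ) ≤
      165888 * n ^ 2 * pr (fun π => lin c π ∉ ({0, 1} : Set ℝ)) := by
  classical
  have h := (card_nonaligned_mul_le_card_configs hn c hW hheavy).trans
    (Nat.mul_le_mul_left _ (card_configs_le c hW))
  have hf : (0 : ℝ) < n.factorial := by exact_mod_cast n.factorial_pos
  have h' : (#(nonaligned W) : ℝ) * n.factorial ≤ 128 * (4 *
      (#{π : Perm (Fin n) | lin c π ∉ ({0, 1} : Set ℝ)} * (18 * n) ^ 2)) := by exact_mod_cast h
  rw [pr_eq, ← mul_div_assoc, le_div_iff₀ hf]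
  refine h'.trans (le_of_eq ?_)
  ring

/-! ### Exactly Boolean linear functions -/

theorem exists_ne_three {n : ℕ} (hn : 4 ≤ n) (a b d : Fin n) : ∃ x, x ≠ a ∧ x ≠ b ∧ x ≠ d := by
  have h : #({a, b, d} : Finset (Fin n)) < #(univ : Finset (Fin n)) := by
    rw [card_univ, Fintype.card_fin]
    exact card_le_three.trans_lt hn
  obtain ⟨x, -, hx⟩ := exists_mem_notMem_of_card_lt_card h
  simp only [mem_insert, mem_singleton, not_or] at hx
  exact ⟨x, hx⟩

/-- An equivalence relation on at least four points either relates all points but one, or has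
two disjoint unrelated pairs. -/
theorem exists_forall_ne_or_exists_matching {n : ℕ} (hn : 4 ≤ n) {r : Fin n → Fin n → Prop}
    (hr : Equivalence r) :
    (∃ v, ∀ a b, a ≠ v → b ≠ v → r a b) ∨
      ∃ i j i' j', i ≠ i' ∧ i ≠ j' ∧ j ≠ i' ∧ j ≠ j' ∧ ¬ r i j ∧ ¬ r i' j' := by
  by_contra hcon
  rw [not_or] at hcon
  obtain ⟨hv, hM⟩ := hcon
  have hM' : ∀ i j i' j', ¬ r i j → i ≠ i' → i ≠ j' → j ≠ i' → j ≠ j' → r i' j' :=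
    fun i j i' j' h h1 h2 h3 h4 => by_contra fun h5 => hM ⟨i, j, i', j', h1, h2, h3, h4, h, h5⟩
  -- If i is unrelated to both j and a, then every other point is related to a, so i is the
  -- exceptional point. Only x = j needs a detour, through a fourth point b.
  have key : ∀ i j a, ¬ r i j → a ≠ i → a ≠ j → r a i := by
    intro i j a hij hai haj
    by_contra ha
    have h : ∀ x, x ≠ i → r x a := by
      intro x hx
      by_cases hxa : x = a
      · rw [hxa]
        exact hr.refl a
      by_cases hxj : x = j
      · obtain ⟨b, hbi, hbj, hba⟩ := exists_ne_three hn i j a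
        rw [hxj]
        exact hr.trans (hM' a i j b ha haj hba.symm (hxj ▸ hx.symm) hbi.symm)
          (hM' i j b a hij hbi.symm hai.symm hbj.symm haj.symm)
      · exact hM' i j x a hij (Ne.symm hx) hai.symm (Ne.symm hxj) haj.symm
    exact hv ⟨i, fun x y hx hy => hr.trans (h x hx) (hr.symm (h y hy))⟩
  obtain ⟨i, j, hij⟩ : ∃ i j, ¬ r i j := by
    by_contra! hall
    exact hv ⟨⟨0, by omega⟩, fun a b _ _ => hall a b⟩
  obtain ⟨a, hai, haj, -⟩ := exists_ne_three hn i j j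
  exact hij (hr.trans (hr.symm (key i j a hij hai haj))
    (key j i a (fun h => hij (hr.symm h)) haj hai))

/-- Two nonconstant functions which never differ on disjoint pairs of points are both constant
away from a common point. -/
theorem exists_common_exceptional_point {n : ℕ} (hn : 4 ≤ n) {d d' : Fin n → ℝ}
    (hd : ∃ k l, d k ≠ d l) (hd' : ∃ k l, d' k ≠ d' l)
    (H : ∀ k l k' l', k ≠ k' → k ≠ l' → l ≠ k' → l ≠ l' → d k ≠ d l → d' k' = d' l') :
    ∃ v, (∀ a, a ≠ v → d v ≠ d a) ∧ (∀ a, a ≠ v → d' v ≠ d' a) ∧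
      (∀ a b, a ≠ v → b ≠ v → d a = d b) ∧ ∀ a b, a ≠ v → b ≠ v → d' a = d' b := by
  -- The pair k, l makes d' constant off {k, l}. A further exception at l would force d k = d y = d
  -- l for a fourth point y; so k is the only one.
  have key : ∀ k l m, d k ≠ d l → m ≠ k → m ≠ l → d' k ≠ d' m →
      ∃ v, (∀ a b, a ≠ v → b ≠ v → d a = d b) ∧ ∀ a b, a ≠ v → b ≠ v → d' a = d' b := by
    intro k l m hkl hmk hml hkm
    have hoff : ∀ x, x ≠ k → x ≠ l → d' x = d' m := fun x h1 h2 =>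
      H k l x m h1.symm hmk.symm h2.symm hml.symm hkl
    have hlm : d' l = d' m := by
      by_contra hlm
      obtain ⟨y, hyk, hyl, hym⟩ := exists_ne_three hn k l m
      have hk : d k = d y := by
        by_contra h
        exact hlm (H k y l m (fun h => hkl (by rw [h])) hmk.symm hyl hym h)
      have hl : d l = d y := by
        by_contra h
        exact hkm (H l y k m (fun h => hkl (by rw [h])) hml.symm hyk hym h)
      exact hkl (hk.trans hl.symm)
    have hall : ∀ x, x ≠ k → d' x = d' m := by
      intro x hx
      by_cases hxl : x = l
      · rw [hxl, hlm]
      · exact hoff x hx hxl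
    refine ⟨k, fun a b ha hb => ?_, fun a b ha hb => (hall a ha).trans (hall b hb).symm⟩
    by_contra hab
    obtain ⟨x, hxk, hxa, hxb⟩ := exists_ne_three hn k a b
    exact hkm ((H a b k x ha hxa.symm hb hxb.symm hab).trans (hall x hxk))
  have main : ∃ v, (∀ a b, a ≠ v → b ≠ v → d a = d b) ∧ ∀ a b, a ≠ v → b ≠ v → d' a = d' b := by
    obtain ⟨k, l, hkl⟩ := hd
    obtain ⟨m, hmk, hml, -⟩ := exists_ne_three hn k l l
    by_cases h1 : d' k = d' m
    · by_cases h2 : d' l = d' m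
      · exfalso
        have hall : ∀ x, d' x = d' m := by
          intro x
          by_cases hxk : x = k
          · rw [hxk, h1]
          by_cases hxl : x = l
          · rw [hxl, h2]
          exact H k l x m (Ne.symm hxk) hmk.symm (Ne.symm hxl) hml.symm hkl
        obtain ⟨a, b, hab⟩ := hd'
        exact hab ((hall a).trans (hall b).symm)
      · exact key l k m hkl.symm hml hmk h2
    · exact key k l m hkl hmk hml h1
  have hne : ∀ (d : Fin n → ℝ) v, (∃ k l, d k ≠ d l) → (∀ a b, a ≠ v → b ≠ v → d a = d b) →
      ∀ a, a ≠ v → d v ≠ d a := by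
    rintro d v ⟨k, l, hkl⟩ hoff a ha hva
    have hall : ∀ x, d x = d a := by
      intro x
      by_cases hx : x = v
      · rw [hx, hva]
      · exact hoff x a hx ha
    exact hkl ((hall k).trans (hall l).symm)
  obtain ⟨v, h1, h2⟩ := main
  exact ⟨v, hne d v hd h1, hne d' v hd' h2, h1, h2⟩

theorem minor_eq_zero_of_disjoint {n : ℕ} {c : Fin n → Fin n → ℝ}
    (h : ∀ π, lin c π ∈ ({0, 1} : Set ℝ)) {i j i' j' k l k' l' : Fin n}
    (h1 : i ≠ i') (h2 : i ≠ j') (h3 : j ≠ i') (h4 : j ≠ j')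
    (g1 : k ≠ k') (g2 : k ≠ l') (g3 : l ≠ k') (g4 : l ≠ l') (hm : minor c i j k l ≠ 0) :
    minor c i' j' k' l' = 0 := by
  by_contra hm'
  have n1 : i ≠ j := fun he => hm (by unfold minor; rw [he]; ring)
  have n2 : k ≠ l := fun he => hm (by unfold minor; rw [he]; ring)
  have n3 : i' ≠ j' := fun he => hm' (by unfold minor; rw [he]; ring)
  have n4 : k' ≠ l' := fun he => hm' (by unfold minor; rw [he]; ring)
  have ha : Function.Injective ![i, j, i', j'] := by
    intro s t
    fin_cases s <;> fin_cases t <;> simp [*, Ne.symm, eq_comm]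
  have hb : Function.Injective ![k, l, k', l'] := by
    intro s t
    fin_cases s <;> fin_cases t <;> simp [*, Ne.symm, eq_comm]
  obtain ⟨π, hπ⟩ := Perm.exists_extending_pair (f := ![i, j, i', j']) (g := ![k, l, k', l']) ha hb
  have e0 : π i = k := hπ 0
  have e1 : π j = l := hπ 1
  have e2 : π i' = k' := hπ 2
  have e3 : π j' = l' := hπ 3
  obtain ⟨s, hs⟩ := exists_twist_lin_notMem c π (z := (i, j)) (z' := (i', j')) h1 h2 h3 h4
    (by simpa [e0, e1] using hm) (by simpa [e2, e3] using hm')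
  exact hs (h _)

/-- If both alternatives fail, there are two disjoint unrelated row pairs and two disjoint unrelated
column pairs. By `hstar` both row differences have the same single exceptional column v, yet some
nonzero minor avoids v. Its rows must meet both row pairs; re-pairing the four rows gives a second
exceptional column v', and the two columns contradict each other. -/
theorem exists_line_minor_eq_zero_of_four_le {n : ℕ} (hn : 4 ≤ n) {c : Fin n → Fin n → ℝ}
    (h : ∀ π, lin c π ∈ ({0, 1} : Set ℝ)) :
    (∃ r, ∀ i j, i ≠ r → j ≠ r → ∀ k l, minor c i j k l = 0) ∨
      ∃ r, ∀ k l, k ≠ r → l ≠ r → ∀ i j, minor c i j k l = 0 := by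
  have hrow : Equivalence fun i j => ∀ k l, minor c i j k l = 0 := by
    refine ⟨fun i k l => by unfold minor; ring, fun {i j} h k l => ?_, fun {i j a} h h' k l => ?_⟩
    · have := h k l
      unfold minor at *
      linarith
    · have h1 := h k l
      have h2 := h' k l
      unfold minor at *
      linarith
  have hcol : Equivalence fun k l => ∀ i j, minor c i j k l = 0 := by
    refine ⟨fun i k l => by unfold minor; ring, fun {i j} h k l => ?_, fun {i j a} h h' k l => ?_⟩
    · have := h k l
      unfold minor at *
      linarith
    · have h1 := h k l
      have h2 := h' k l
      unfold minor at *
      linarith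
  have hstar : ∀ i j i' j', i ≠ i' → i ≠ j' → j ≠ i' → j ≠ j' →
      (∃ k l, minor c i j k l ≠ 0) → (∃ k l, minor c i' j' k l ≠ 0) →
      ∃ v, (∀ a, a ≠ v → minor c i j v a ≠ 0) ∧ (∀ a, a ≠ v → minor c i' j' v a ≠ 0) ∧
        (∀ a b, a ≠ v → b ≠ v → minor c i j a b = 0) ∧
        ∀ a b, a ≠ v → b ≠ v → minor c i' j' a b = 0 := by
    have hm : ∀ i j k l, minor c i j k l = (c i k - c j k) - (c i l - c j l) := by
      intros
      unfold minor
      ring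
    intro i j i' j' h1 h2 h3 h4 hij hij'
    simp only [hm, sub_ne_zero, sub_eq_zero] at hij hij' ⊢
    refine exists_common_exceptional_point hn hij hij' fun k l k' l' g1 g2 g3 g4 hne => ?_
    have := minor_eq_zero_of_disjoint h h1 h2 h3 h4 g1 g2 g3 g4
      (by rw [hm]; exact sub_ne_zero.2 hne)
    rw [hm] at this
    exact sub_eq_zero.1 this
  rcases exists_forall_ne_or_exists_matching hn hrow with hr |
    ⟨i, j, i', j', h1, h2, h3, h4, hij, hij'⟩
  · exact Or.inl hr
  rcases exists_forall_ne_or_exists_matching hn hcol with hc |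
    ⟨k₁, l₁, k₂, l₂, g1, g2, g3, g4, hkl₁, hkl₂⟩
  · exact Or.inr hc
  exfalso
  push Not at hij hij' hkl₁ hkl₂
  obtain ⟨v, hv1, hv2, hv3, hv4⟩ := hstar i j i' j' h1 h2 h3 h4 hij hij'
  obtain ⟨k, l, a, b, hk, hl, hab⟩ : ∃ k l a b, k ≠ v ∧ l ≠ v ∧ minor c a b k l ≠ 0 := by
    by_cases hk : k₁ ≠ v ∧ l₁ ≠ v
    · obtain ⟨a, b, hab⟩ := hkl₁
      exact ⟨k₁, l₁, a, b, hk.1, hk.2, hab⟩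
    · obtain ⟨a, b, hab⟩ := hkl₂
      refine ⟨k₂, l₂, a, b, ?_, ?_, hab⟩ <;> rintro rfl <;> tauto
  have e1 := hv3 k l hk hl
  have e2 := hv4 k l hk hl
  obtain ⟨x, hxv, hxk, hxl⟩ := exists_ne_three hn v k l
  have m1 : a = i ∨ a = j ∨ b = i ∨ b = j := by
    by_contra! hcon
    exact hab (minor_eq_zero_of_disjoint h hcon.1.symm hcon.2.2.1.symm hcon.2.1.symm
      hcon.2.2.2.symm hk.symm hl.symm hxk hxl (hv1 x hxv))
  have m2 : a = i' ∨ a = j' ∨ b = i' ∨ b = j' := by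
    by_contra! hcon
    exact hab (minor_eq_zero_of_disjoint h hcon.1.symm hcon.2.2.1.symm hcon.2.1.symm
      hcon.2.2.2.symm hk.symm hl.symm hxk hxl (hv2 x hxv))
  have hii : minor c i i' k l ≠ 0 := by
    intro h0
    apply hab
    unfold minor at *
    rcases m1 with rfl | rfl | rfl | rfl <;> rcases m2 with h | h | h | h <;>
      first
      | exact absurd h ‹_›
      | (subst h; linarith)
  have hij2 : minor c i j' k l ≠ 0 := fun h0 => hii (by unfold minor at *; linarith)
  have hji2 : minor c j i' k l ≠ 0 := fun h0 => hii (by unfold minor at *; linarith)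
  have hij1 : i ≠ j := fun he => hv1 x hxv (by unfold minor; rw [he]; ring)
  have hij1' : i' ≠ j' := fun he => hv2 x hxv (by unfold minor; rw [he]; ring)
  obtain ⟨v', hw1, hw2, hw3, hw4⟩ := hstar i j' j i' hij1 h1 h4.symm hij1'.symm
    ⟨k, l, hij2⟩ ⟨k, l, hji2⟩
  have hvv : v' ≠ v := by
    rintro rfl
    exact hij2 (hw3 k l hk hl)
  obtain ⟨y, hyv, hyv', hyx⟩ := exists_ne_three hn v v' x
  obtain ⟨z, hzv, hzv', hzy⟩ := exists_ne_three hn v v' y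
  have f1 : minor c i i' v z ≠ 0 := by
    have p1 := hv1 z hzv
    have p2 := hw4 v z hvv.symm hzv'
    intro h0
    apply p1
    unfold minor at *
    linarith
  refine hw1 y hyv' ?_
  have p3 := minor_eq_zero_of_disjoint h hij1 h2 h3.symm hij1' hvv.symm hyv.symm hzv' hzy f1
  have p4 := hv3 v' y hvv hyv
  unfold minor at *
  linarith

theorem minor_eq_zero_of_lt {n : ℕ} {c : Fin n → Fin n → ℝ} {r : Fin n}
    (h : ∀ i j, i ≠ r → j ≠ r → i < j → ∀ k l, k < l → minor c i j k l = 0) (i j : Fin n)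
    (hi : i ≠ r) (hj : j ≠ r) (k l : Fin n) : minor c i j k l = 0 := by
  have h1 : ∀ i j, i ≠ r → j ≠ r → i < j → ∀ k l, minor c i j k l = 0 := by
    intro i j hi hj hij k l
    rcases lt_trichotomy k l with hkl | rfl | hkl
    · exact h i j hi hj hij k l hkl
    · unfold minor
      ring
    · have := h i j hi hj hij l k hkl
      unfold minor at *
      linarith
  rcases lt_trichotomy i j with hij | rfl | hij
  · exact h1 i j hi hj hij k l
  · unfold minor
    ring
  · have := h1 j i hj hi hij k l
    unfold minor at *
    linarith

theorem exists_line_minor_eq_zero_of_three {c : Fin 3 → Fin 3 → ℝ}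
    (h : ∀ π, lin c π ∈ ({0, 1} : Set ℝ)) :
    (∃ r, ∀ i j, i ≠ r → j ≠ r → ∀ k l, minor c i j k l = 0) ∨
      ∃ r, ∀ k l, k ≠ r → l ≠ r → ∀ i j, minor c i j k l = 0 := by
  have key : ∀ a b d e f g : ℝ, (a = 0 ∨ a = 1) → (b = 0 ∨ b = 1) → (d = 0 ∨ d = 1) →
      (e = 0 ∨ e = 1) → (f = 0 ∨ f = 1) → (g = 0 ∨ g = 1) → a + b + d = e + f + g →
      (a = e ∧ b = f ∧ d = g) ∨ (a = e ∧ b = g ∧ d = f) ∨ (a = f ∧ b = e ∧ d = g) ∨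
      (a = f ∧ b = g ∧ d = e) ∨ (a = g ∧ b = e ∧ d = f) ∨ (a = g ∧ b = f ∧ d = e) := by
    intro a b d e f g ha hb hd he hf hg hs
    rcases ha with rfl | rfl <;> rcases hb with rfl | rfl <;> rcases hd with rfl | rfl <;>
      rcases he with rfl | rfl <;> rcases hf with rfl | rfl <;> rcases hg with rfl | rfl <;>
      first
      | (exfalso; norm_num at hs; done)
      | simp
  have q0 := h 1
  have q1 := h (swap 0 1)
  have q2 := h (swap 0 2)
  have q3 := h (swap 1 2)
  have q4 := h (swap 0 1 * swap 1 2)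
  have q5 := h (swap 1 2 * swap 0 1)
  have s01 : swap (0 : Fin 3) 1 2 = 2 := by decide
  have s02 : swap (0 : Fin 3) 2 1 = 1 := by decide
  have s12 : swap (1 : Fin 3) 2 0 = 0 := by decide
  simp only [lin, Fin.sum_univ_three, Perm.mul_apply, Perm.one_apply, swap_apply_left,
    swap_apply_right, s01, s02, s12, Set.mem_insert_iff, Set.mem_singleton_iff] at q0 q1 q2 q3 q4 q5
  -- Each cell lies in one even and one odd permutation, so the even and odd values have equal sums
  -- and, being Boolean, can be matched. Each of the six matchings pairs permutations agreeing on a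
  -- fixed row or on a fixed column, and each equality is a vanishing minor off that line.
  have := key _ _ _ _ _ _ q0 q4 q5 q1 q2 q3 (by ring)
  rcases this with h | h | h | h | h | h
  · exact Or.inl ⟨2, minor_eq_zero_of_lt fun i j hi hj hij k l hkl => by
      fin_cases i <;> fin_cases j <;> simp at hi hj hij <;> fin_cases k <;> fin_cases l <;>
        simp at hkl <;> (simp [minor]; linarith)⟩
  · refine Or.inr ⟨2, fun k l hk hl i j => ?_⟩
    rw [← minor_transpose]
    refine minor_eq_zero_of_lt (fun i j hi hj hij k l hkl => ?_) k l hk hl i j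
    fin_cases i <;> fin_cases j <;> simp at hi hj hij <;> fin_cases k <;> fin_cases l <;>
      simp at hkl <;> (simp [minor]; linarith)
  · refine Or.inr ⟨1, fun k l hk hl i j => ?_⟩
    rw [← minor_transpose]
    refine minor_eq_zero_of_lt (fun i j hi hj hij k l hkl => ?_) k l hk hl i j
    fin_cases i <;> fin_cases j <;> simp at hi hj hij <;> fin_cases k <;> fin_cases l <;>
      simp at hkl <;> (simp [minor]; linarith)
  · exact Or.inl ⟨1, minor_eq_zero_of_lt fun i j hi hj hij k l hkl => by
      fin_cases i <;> fin_cases j <;> simp at hi hj hij <;> fin_cases k <;> fin_cases l <;>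
        simp at hkl <;> (simp [minor]; linarith)⟩
  · exact Or.inl ⟨0, minor_eq_zero_of_lt fun i j hi hj hij k l hkl => by
      fin_cases i <;> fin_cases j <;> simp at hi hj hij <;> fin_cases k <;> fin_cases l <;>
        simp at hkl <;> (simp [minor]; linarith)⟩
  · refine Or.inr ⟨0, fun k l hk hl i j => ?_⟩
    rw [← minor_transpose]
    refine minor_eq_zero_of_lt (fun i j hi hj hij k l hkl => ?_) k l hk hl i j
    fin_cases i <;> fin_cases j <;> simp at hi hj hij <;> fin_cases k <;> fin_cases l <;>
      simp at hkl <;> (simp [minor]; linarith)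

theorem exists_line_minor_eq_zero {n : ℕ} (hn : 0 < n) {c : Fin n → Fin n → ℝ}
    (h : ∀ π, lin c π ∈ ({0, 1} : Set ℝ)) :
    (∃ r, ∀ i j, i ≠ r → j ≠ r → ∀ k l, minor c i j k l = 0) ∨
      ∃ r, ∀ k l, k ≠ r → l ≠ r → ∀ i j, minor c i j k l = 0 := by
  rcases Nat.lt_or_ge n 4 with hn4 | hn4
  · rcases Nat.lt_or_ge n 3 with hn3 | hn3
    · refine Or.inl ⟨⟨0, hn⟩, fun i j hi hj k l => ?_⟩
      have : i = j := by
        rw [Ne, Fin.ext_iff] at hi hj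
        ext
        simp only at hi hj
        omega
      unfold minor
      rw [this]
      ring
    · obtain rfl : n = 3 := by omega
      exact exists_line_minor_eq_zero_of_three h
  · exact exists_line_minor_eq_zero_of_four_le hn4 h

/-! ### Assembling the bounds -/

theorem eight_mul_sq_le_card_nonaligned {n : ℕ} {W : Finset (Fin n × Fin n)} (hW : #W = 4 * n) :
    8 * n ^ 2 ≤ #(nonaligned W) := by
  have h : ∀ u ∈ W, 2 * n ≤ #{v ∈ W | u.1 ≠ v.1 ∧ u.2 ≠ v.2} := by
    intro u _
    have hsub : W ⊆ {v ∈ W | u.1 ≠ v.1 ∧ u.2 ≠ v.2} ∪ (({u.1} ×ˢ univ) ∪ (univ ×ˢ {u.2})) := by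
      intro v hv
      simp only [mem_union, mem_filter, mem_product, mem_singleton, mem_univ, hv,
        true_and, and_true]
      tauto
    have h1 := (card_le_card hsub).trans (card_union_le _ _)
    have h2 := card_union_le (({u.1} : Finset (Fin n)) ×ˢ (univ : Finset (Fin n)))
      (univ ×ˢ {u.2})
    rw [card_product, card_product, card_univ, Fintype.card_fin, card_singleton,
      card_singleton] at h2
    omega
  rw [card_nonaligned]
  calc 8 * n ^ 2 = #W * (2 * n) := by rw [hW]; ring
    _ = ∑ _u ∈ W, 2 * n := by simp
    _ ≤ _ := sum_le_sum h

theorem exists_line_card_heavyCells_le {n : ℕ} (hn : 32 ≤ n) {c : Fin n → Fin n → ℝ} {ε δ : ℝ}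
    (hε : pr (fun π => lin c π ∉ ({0, 1} : Set ℝ)) ≤ ε) (hδ : 0 < δ)
    (hεδ : 10 ^ 10 * ε ≤ δ ^ 2) (h1 : δ ≤ pr fun π => lin c π = 1)
    (h2 : (pr fun π => lin c π = 1) ≤ 1 - δ) :
    ∃ r, (#{p ∈ heavyCells c | p.1 ≠ r} : ℝ) ≤ 3317760 * n * (ε / δ) ∨
      (#{p ∈ heavyCells c | p.2 ≠ r} : ℝ) ≤ 3317760 * n * (ε / δ) := by
  have hn' : (0 : ℝ) < n := by exact_mod_cast (by omega : 0 < n)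
  have hw := mul_card_heavyCells_ge c (by omega) h1 h2
  set W := heavyCells c with hW
  have hpairs : ∀ W' ⊆ W, #W' ≤ 4 * n → (#(nonaligned W') : ℝ) ≤ 165888 * n ^ 2 * ε :=
    fun W' hsub hcard => (card_nonaligned_mul_le hn c hcard hsub).trans (by gcongr)
  have hδ2 : δ ^ 2 ≤ 1 := by nlinarith
  -- The pair bound needs at most 4n cells; if W had more, a subset of exactly 4n would have 8n²
  -- nonaligned pairs, too many for such a small ε.
  have hcard : #W ≤ 4 * n := by
    by_contra! hlt
    obtain ⟨W', hsub, hW'⟩ := exists_subset_card_eq hlt.le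
    have h3 := hpairs W' hsub hW'.le
    have h4 : (8 : ℝ) * n ^ 2 ≤ #(nonaligned W') := by
      exact_mod_cast eight_mul_sq_le_card_nonaligned hW'
    have h5 : (0 : ℝ) < n ^ 2 := by positivity
    nlinarith
  have hN := hpairs W subset_rfl hcard
  have hwpos : (0 : ℝ) < #W := by nlinarith [mul_pos hδ hn']
  have hsq : (δ * n) ^ 2 ≤ (4 * #W : ℝ) ^ 2 := pow_le_pow_left₀ (by positivity) hw 2
  have hsmall : 100 * #(nonaligned W) ≤ #W ^ 2 := by
    have h5 : (0 : ℝ) < n ^ 2 := by positivity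
    have h6 := mul_le_mul_of_nonneg_right hεδ h5.le
    have : (100 : ℝ) * #(nonaligned W) ≤ (#W : ℝ) ^ 2 := by
      have hε0 : 0 ≤ (n : ℝ) ^ 2 * ε := by
        have := (Nat.cast_nonneg (α := ℝ) #(nonaligned W)).trans hN
        linarith
      linarith
    exact_mod_cast this
  -- Dividing by |W| ≥ δn/4 gives the constant 3317760 = 4 · 5 · 165888.
  have hfin : ∀ m : ℕ, m * #W ≤ 5 * #(nonaligned W) → (m : ℝ) ≤ 3317760 * n * (ε / δ) := by
    intro m hm
    have hm' : (m : ℝ) * #W ≤ 5 * #(nonaligned W) := by exact_mod_cast hm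
    rw [mul_div_assoc', le_div_iff₀ hδ]
    refine le_of_mul_le_mul_right ?_ hn'
    have h7 := mul_le_mul_of_nonneg_left hw (Nat.cast_nonneg (α := ℝ) m)
    linarith
  obtain ⟨r, hr⟩ := exists_line_card_off_mul_le (card_pos.1 (by exact_mod_cast hwpos)) hsmall
  exact ⟨r, hr.imp (hfin _) (hfin _)⟩

theorem exists_isDictator_of_le {n : ℕ} (hn : 32 ≤ n) {c : Fin n → Fin n → ℝ} {ε δ : ℝ}
    (hε : pr (fun π => lin c π ∉ ({0, 1} : Set ℝ)) ≤ ε) (hδ : 0 < δ)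
    (hεδ : 10 ^ 10 * ε ≤ δ ^ 2) (h1 : δ ≤ pr fun π => lin c π = 1)
    (h2 : (pr fun π => lin c π = 1) ≤ 1 - δ) :
    ∃ g : Perm (Fin n) → ℝ, IsDictator g ∧
      pr (fun π => lin c π ≠ g π) ≤ ε + 13271040 * (ε / δ) := by
  classical
  have hn' : (0 : ℝ) < n := by exact_mod_cast (by omega : 0 < n)
  have hbound : ∀ t m : ℕ, t ≤ 4 * m → (m : ℝ) ≤ 3317760 * n * (ε / δ) →
      (t : ℝ) / n ≤ 13271040 * (ε / δ) := by
    intro t m htm hm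
    have htm' : (t : ℝ) ≤ 4 * m := by exact_mod_cast htm
    rw [div_le_iff₀ hn']
    linarith
  obtain ⟨r, hr⟩ := exists_line_card_heavyCells_le hn hε hδ hεδ h1 h2
  have hR : (univ.erase r).Nonempty := by
    rw [← card_pos, card_erase_of_mem (mem_univ _), card_univ, Fintype.card_fin]
    omega
  rcases hr with hr | hr
  · obtain ⟨y, -, x, hyx⟩ := exists_card_support_le c hR
    obtain ⟨g, hg, hle⟩ := exists_isDictator_of_support c r y x
    refine ⟨g, hg, hle.trans (add_le_add hε (hbound _ _ hyx ?_))⟩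
    simpa using hr
  · obtain ⟨y, -, x, hyx⟩ := exists_card_support_le (fun i j => c j i) hR
    obtain ⟨g, hg, hle⟩ := exists_isDictator_of_support_transpose c r y x
    refine ⟨g, hg, hle.trans (add_le_add hε (hbound _ _ hyx ?_))⟩
    rw [heavyCells_transpose, filter_map, card_map]
    simpa using hr

theorem exists_isDictator_of_forall_mem {n : ℕ} (hn : 0 < n) {c : Fin n → Fin n → ℝ}
    (h : ∀ π, lin c π ∈ ({0, 1} : Set ℝ)) :
    ∃ g : Perm (Fin n) → ℝ, IsDictator g ∧ pr (fun π => lin c π ≠ g π) ≤ 0 := by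
  have hzero : pr (fun π => lin c π ∉ ({0, 1} : Set ℝ)) = 0 := by
    classical
    rw [pr_eq, filter_eq_empty_iff.2 fun π _ hπ => hπ (h π)]
    simp
  have hsupp : ∀ (d : Fin n → Fin n → ℝ) r,
      (∀ i j, i ≠ r → j ≠ r → ∀ k l, minor d i j k l = 0) →
      ∃ y x, support d (univ.erase r) y x = ∅ := by
    intro d r hd
    by_cases hy : ∃ y, y ≠ r
    · obtain ⟨y, hy⟩ := hy
      refine ⟨y, r, eq_empty_of_forall_notMem fun p hp => ?_⟩
      obtain ⟨hp, hm⟩ := mem_support.1 hp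
      exact hm (hd _ _ (ne_of_mem_erase hp) hy _ _)
    · push Not at hy
      refine ⟨r, r, eq_empty_of_forall_notMem fun p hp => ?_⟩
      exact ne_of_mem_erase (mem_support.1 hp).1 (hy _)
  rcases exists_line_minor_eq_zero hn h with ⟨r, hr⟩ | ⟨r, hr⟩
  · obtain ⟨y, x, hyx⟩ := hsupp c r hr
    obtain ⟨g, hg, hle⟩ := exists_isDictator_of_support c r y x
    exact ⟨g, hg, by rwa [hyx, hzero, card_empty, Nat.cast_zero, zero_div, add_zero] at hle⟩
  · obtain ⟨y, x, hyx⟩ := hsupp (fun i j => c j i) r fun k l hk hl i j => by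
      rw [minor_transpose]
      exact hr k l hk hl i j
    obtain ⟨g, hg, hle⟩ := exists_isDictator_of_support_transpose c r y x
    exact ⟨g, hg, by rwa [hyx, hzero, card_empty, Nat.cast_zero, zero_div, add_zero] at hle⟩

/-- One bad permutation already has probability 1/n! ≥ 1/31! > 10⁻³⁵. -/
theorem forall_mem_of_pr_lt {n : ℕ} (hn : n < 32) {c : Fin n → Fin n → ℝ}
    (h : pr (fun π => lin c π ∉ ({0, 1} : Set ℝ)) < 1 / (10 : ℝ) ^ 35) (π : Perm (Fin n)) :
    lin c π ∈ ({0, 1} : Set ℝ) := by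
  classical
  by_contra hπ
  have hf : (0 : ℝ) < n.factorial := by exact_mod_cast n.factorial_pos
  have hf' : (n.factorial : ℝ) ≤ 10 ^ 35 := by
    have h1 : n.factorial ≤ Nat.factorial 31 := Nat.factorial_le (by omega)
    have h2 : Nat.factorial 31 ≤ 10 ^ 35 := by norm_num [Nat.factorial]
    exact_mod_cast h1.trans h2
  have hc : (1 : ℝ) ≤ #{π | lin c π ∉ ({0, 1} : Set ℝ)} := by
    exact_mod_cast card_pos.2 ⟨π, mem_filter.2 ⟨mem_univ _, hπ⟩⟩
  rw [pr_eq] at h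
  exact absurd h (not_lt.2 (div_le_div₀ (zero_le_one.trans hc) hc hf hf'))

end SymFKN

theorem theorem7 :
    ∃ K : ℝ, 0 < K ∧ ∃ M : ℝ, 0 < M ∧
      ∀ (n : ℕ) (f : Equiv.Perm (Fin n) → ℝ) (ε δ : ℝ),
        SymFKN.IsLinear f →
        SymFKN.pr (fun π => f π ∉ ({0, 1} : Set ℝ)) ≤ ε →
        0 < δ →
        K * Real.sqrt ε ≤ δ →
        δ ≤ SymFKN.pr (fun π => f π = 1) →
        SymFKN.pr (fun π => f π = 1) ≤ 1 - δ →
        ∃ g : Equiv.Perm (Fin n) → ℝ, SymFKN.IsDictator g ∧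
          SymFKN.pr (fun π => f π ≠ g π) ≤ M * (ε / δ) := by
  -- K is large enough that K² = 10⁴⁰ gives ε < 10⁻³⁵ for small n. M is 4 · 3317760 plus 1, which
  -- absorbs ε ≤ ε/δ.
  refine ⟨10 ^ 20, by norm_num, 13271041, by norm_num, ?_⟩
  intro n f ε δ hf hε hδ hK h1 h2
  obtain ⟨c, hc⟩ := hf
  obtain rfl : f = SymFKN.lin c := funext fun π => by rw [hc, SymFKN.sum_cosetInd_eq_lin]
  have hε0 : 0 ≤ ε := le_trans (by unfold SymFKN.pr; positivity) hε
  have hδ1 : δ ≤ 1 / 2 := by linarith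
  have hsq : 10 ^ 40 * ε ≤ δ ^ 2 := by
    have h := pow_le_pow_left₀ (by positivity) hK 2
    rw [mul_pow, Real.sq_sqrt hε0] at h
    linarith
  rcases Nat.lt_or_ge n 32 with hn | hn
  · have hpos : 0 < n := by
      rcases n.eq_zero_or_pos with rfl | hpos
      · exfalso
        -- On the empty set f is an empty sum, hence 0, which contradicts 0 < δ.
        have : SymFKN.pr (fun π => SymFKN.lin c π = 1) = 0 := by
          classical
          rw [SymFKN.pr_eq, Finset.filter_eq_empty_iff.2 fun π _ hπ => ?_]
          · simp
          · simp [SymFKN.lin] at hπ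
        linarith
      · exact hpos
    have hlt : ε < 1 / (10 : ℝ) ^ 35 := by
      have : δ ^ 2 ≤ 1 := by nlinarith
      rw [lt_div_iff₀ (by positivity)]
      linarith
    obtain ⟨g, hg, hle⟩ := SymFKN.exists_isDictator_of_forall_mem hpos
      (SymFKN.forall_mem_of_pr_lt hn (hε.trans_lt hlt))
    exact ⟨g, hg, hle.trans (by positivity)⟩
  · obtain ⟨g, hg, hle⟩ := SymFKN.exists_isDictator_of_le hn hε hδ (by linarith) h1 h2
    refine ⟨g, hg, hle.trans ?_⟩
    have : ε ≤ ε / δ := by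
      rw [le_div_iff₀ hδ]
      nlinarith
    linarith
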